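/- Let $n>1$ and let $M$ be a smooth manifold of dimension $2n+1$ (Hausdorff, second countable, without boundary) carrying a smooth Riemannian metric $g$ with Levi-Civita connection $\nabla$ and curvature $R(X,Y)Z=\nabla_X\nabla_YZ-\nabla_Y\nabla_XZ-\nabla_{[X,Y]}Z$. Let $(\varphi,\xi,\eta)$ be a smooth $(1,1)$-tensor field, vector field (the Reeb field) and $1$-form on $M$ such that $$\varphi^2=-\mathrm{id}+\eta\otimes\xi,\qquad \eta(\xi)=1,\qquad g(\varphi X,\varphi Y)=g(X,Y)-\eta(X)\eta(Y),$$ and suppose that $M(\varphi,\xi,\eta,g)$ is a Kenmotsu manifold, i.e. for all smooth vector fields $X,Y$ $$(\nabla_X\varphi)Y=g(\varphi X,Y)\,\xi-\eta(Y)\,\varphi X .$$ Let $\mathrm{Ric}^*(X,Y)=\tfrac12\,\mathrm{tr}\{\varphi\circ R(X,\varphi Y)\}$ be the $*$-Ricci tensor. Suppose that $g$ is an almost $*$-Ricci soliton, i.e. there are a smooth vector field $V$ (the potential field) and a smooth function $\lambda:M\to\mathbb R$ with $$\tfrac12\,\mathcal L_Vg+\mathrm{Ric}^*=\lambda\,g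 ,$$ and that $V$ is a Jacobi field along $\xi$, i.e. on all of $M$ $$\nabla_\xi\nabla_\xi V+R(V,\xi)\xi=0 .$$ Then $\lambda$ is constant, and the soliton is steady: $\lambda=0$ on $M$. -/

import Mathlib

set_option linter.unusedSectionVars false

open Bundle Set Module
open scoped Manifold ContDiff Topology

noncomputable section

namespace Riem

variable {E : Type*} [NormedAddCommGroup E] [NormedSpace ℝ E] [FiniteDimensional ℝ E]
  {H : Type*} [TopologicalSpace H] {I : ModelWithCorners ℝ E H}
  {M : Type*} [TopologicalSpace M] [ChartedSpace H M] [IsManifold I ∞ M]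

/-- Smooth global vector fields on `M`. -/
def SmoothField (X : Π x : M, TangentSpace I x) : Prop :=
  ContMDiff I I.tangent ∞ (fun x ↦ (⟨x, X x⟩ : TangentBundle I M))

instance finiteDimensional_tangentSpace (x : M) : FiniteDimensional ℝ (TangentSpace I x) :=
  inferInstanceAs (FiniteDimensional ℝ E)

variable [RiemannianBundle (fun x : M ↦ TangentSpace I x)]

/-- The function `g(X, Y)`. -/
def gm (X Y : Π x : M, TangentSpace I x) : M → ℝ := fun x ↦ inner ℝ (X x) (Y x)

/-- The derivative `X(f)` of a function along a vector field. -/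
def dirDeriv (X : Π x : M, TangentSpace I x) (f : M → ℝ) : M → ℝ :=
  fun x ↦ mvfderiv I f x (X x)

/-- The right-hand side of the Koszul formula, i.e. `2 g(∇_X Y, Z)`. -/
def koszul (X Y Z : Π x : M, TangentSpace I x) (x : M) : ℝ :=
  dirDeriv X (gm Y Z) x + dirDeriv Y (gm X Z) x - dirDeriv Z (gm X Y) x
    + inner ℝ (VectorField.mlieBracket I X Y x) (Z x)
    - inner ℝ (VectorField.mlieBracket I X Z x) (Y x)
    - inner ℝ (VectorField.mlieBracket I Y Z x) (X x)

/-- The Levi-Civita connection `∇_X Y` of the Riemannian metric: the vector at `x` whose inner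
products with an orthonormal basis of the tangent space are given by the Koszul formula (each
basis vector being extended to a vector field that is smooth near `x`; see `two_mul_inner_nabla`
for the independence of these choices). -/
def nabla (X Y : Π x : M, TangentSpace I x) (x : M) : TangentSpace I x :=
  ∑ i, ((1 / 2 : ℝ) * koszul X Y
    (FiberBundle.extend E (stdOrthonormalBasis ℝ (TangentSpace I x) i)) x) •
      stdOrthonormalBasis ℝ (TangentSpace I x) i

section LeviCivita

variable [IsContMDiffRiemannianBundle I ∞ E (fun x : M ↦ TangentSpace I x)]

/-- The function `g(X, Y)` is differentiable where `X` and `Y` are. -/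
theorem mdifferentiableAt_gm {X Y : Π x : M, TangentSpace I x} {x : M}
    (hX : MDiffAt (T% X) x) (hY : MDiffAt (T% Y) x) : MDiffAt (gm X Y) x :=
  MDifferentiableAt.inner_bundle (IM := I) (IB := I) (F := E) (E := fun x : M ↦ TangentSpace I x)
    (b := fun x ↦ x) hX hY

/-- The Koszul expression is tensorial in its last argument. -/
theorem tensorialAt_koszul {X Y : Π x : M, TangentSpace I x} (x : M)
    (hX : MDiffAt (T% X) x) (hY : MDiffAt (T% Y) x) :
    TensorialAt I E (fun Z ↦ koszul X Y Z x) x where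
  smul {f Z} hf hZ := by
    have h1 := mdifferentiableAt_gm hY hZ
    have h2 := mdifferentiableAt_gm hX hZ
    have e1 : gm Y (f • Z) = fun y ↦ f y * gm Y Z y := by
      funext y; simp [gm, inner_smul_right]
    have e2 : gm X (f • Z) = fun y ↦ f y * gm X Z y := by
      funext y; simp [gm, inner_smul_right]
    have d1 := mvfderiv_fun_mul hf h1
    have d2 := mvfderiv_fun_mul hf h2
    simp only [koszul, dirDeriv, e1, e2]
    rw [VectorField.mlieBracket_smul_right hf hZ, VectorField.mlieBracket_smul_right hf hZ]
    rw [d1, d2]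
    simp only [gm]
    simp [inner_add_left, inner_smul_left, inner_smul_right, mvfderiv, real_inner_comm]
    ring
  add {Z Z'} hZ hZ' := by
    have e1 : gm Y (Z + Z') = fun y ↦ gm Y Z y + gm Y Z' y := by
      funext y; simp [gm, inner_add_right]
    have e2 : gm X (Z + Z') = fun y ↦ gm X Z y + gm X Z' y := by
      funext y; simp [gm, inner_add_right]
    have d1 := mvfderiv_fun_add (mdifferentiableAt_gm hY hZ) (mdifferentiableAt_gm hY hZ')
    have d2 := mvfderiv_fun_add (mdifferentiableAt_gm hX hZ) (mdifferentiableAt_gm hX hZ')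
    simp only [koszul, dirDeriv, e1, e2]
    rw [VectorField.mlieBracket_add_right hZ hZ', VectorField.mlieBracket_add_right hZ hZ']
    rw [d1, d2]
    simp [inner_add_left, inner_add_right]
    ring

/-- The Koszul formula `2 g(∇_X Y, Z) = koszul X Y Z` holds for all differentiable `X`, `Y`, `Z`. -/
theorem two_mul_inner_nabla {X Y Z : Π x : M, TangentSpace I x} {x : M}
    (hX : MDiffAt (T% X) x) (hY : MDiffAt (T% Y) x) (hZ : MDiffAt (T% Z) x) :
    2 * inner ℝ (nabla X Y x) (Z x) = koszul X Y Z x := by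
  have hT := tensorialAt_koszul x hX hY
  rw [← TensorialAt.mkHom_apply hT hZ]
  set b := stdOrthonormalBasis ℝ (TangentSpace I x)
  conv_rhs => rw [← b.sum_repr' (Z x)]
  simp only [nabla, map_sum, map_smul, sum_inner, TensorialAt.mkHom_apply_eq_extend,
    Finset.mul_sum, inner_smul_left, smul_eq_mul]
  refine Finset.sum_congr rfl fun i _ ↦ ?_
  simp [b]
  ring

/-- The connection is torsion-free. -/
theorem nabla_torsion_free {X Y : Π x : M, TangentSpace I x} {x : M}
    (hX : MDiffAt (T% X) x) (hY : MDiffAt (T% Y) x) :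
    nabla X Y x - nabla Y X x = VectorField.mlieBracket I X Y x := by
  refine ext_inner_right ℝ fun v ↦ ?_
  have hv : MDiffAt (T% (FiberBundle.extend E v)) x := FiberBundle.mdifferentiableAt_extend ..
  have h1 := two_mul_inner_nabla hX hY hv
  have h2 := two_mul_inner_nabla hY hX hv
  have e : gm Y X = gm X Y := by funext y; simp [gm, real_inner_comm]
  simp only [koszul, FiberBundle.extend_apply_self, VectorField.mlieBracket_swap_apply (V := Y) (W := X), e, inner_neg_left] at h1 h2
  rw [inner_sub_left]
  linarith

/-- The connection is metric. -/
theorem nabla_metric {X Y Z : Π x : M, TangentSpace I x} {x : M}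
    (hX : MDiffAt (T% X) x) (hY : MDiffAt (T% Y) x) (hZ : MDiffAt (T% Z) x) :
    dirDeriv X (gm Y Z) x = inner ℝ (nabla X Y x) (Z x) + inner ℝ (Y x) (nabla X Z x) := by
  have h1 := two_mul_inner_nabla hX hY hZ
  have h2 := two_mul_inner_nabla hX hZ hY
  have e : gm Z Y = gm Y Z := by funext y; simp [gm, real_inner_comm]
  simp only [koszul, VectorField.mlieBracket_swap_apply (V := Z) (W := Y), e, inner_neg_left] at h1 h2
  rw [real_inner_comm (nabla X Z x)]
  linarith

end LeviCivita

/-- The curvature `R(X, Y)Z = ∇_X ∇_Y Z - ∇_Y ∇_X Z - ∇_[X, Y] Z`. -/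
def curv (X Y Z : Π x : M, TangentSpace I x) (x : M) : TangentSpace I x :=
  nabla X (nabla Y Z) x - nabla Y (nabla X Z) x - nabla (VectorField.mlieBracket I X Y) Z x

/-- The curvature tensor at a point, evaluated on tangent vectors through extensions to vector
fields that are smooth near the point. -/
def curvAt (x : M) (u v w : TangentSpace I x) : TangentSpace I x :=
  curv (FiberBundle.extend E u) (FiberBundle.extend E v) (FiberBundle.extend E w) x

/-- The `*`-Ricci tensor `Ric^*(u, v) = (1/2) tr (φ ∘ R(u, φ v))`. -/
def starRicci (φ : Π x : M, TangentSpace I x →L[ℝ] TangentSpace I x) (x : M)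
    (u v : TangentSpace I x) : ℝ :=
  (1 / 2 : ℝ) * ∑ i, inner ℝ (φ x (curvAt x u (φ x v) (stdOrthonormalBasis ℝ (TangentSpace I x) i)))
    (stdOrthonormalBasis ℝ (TangentSpace I x) i)

/-- The Lie derivative `(L_V g)(X, Y) = V(g(X, Y)) - g([V, X], Y) - g(X, [V, Y])`. -/
def lieMetric (V X Y : Π x : M, TangentSpace I x) (x : M) : ℝ :=
  dirDeriv V (gm X Y) x - inner ℝ (VectorField.mlieBracket I V X x) (Y x)
    - inner ℝ (X x) (VectorField.mlieBracket I V Y x)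

/-- An almost contact structure `(φ, ξ, η)` of smooth tensor fields together with a compatible
metric `g` (the Riemannian metric of `M`). -/
structure IsAlmostContactMetric (φ : Π x : M, TangentSpace I x →L[ℝ] TangentSpace I x)
    (ξ : Π x : M, TangentSpace I x) (η : Π x : M, TangentSpace I x →L[ℝ] ℝ) : Prop where
  smooth_phi : ContMDiff I (I.prod 𝓘(ℝ, E →L[ℝ] E)) ∞
    (fun x ↦ TotalSpace.mk' (E →L[ℝ] E) (E := fun x : M ↦ TangentSpace I x →L[ℝ] TangentSpace I x)
      x (φ x))
  smooth_xi : SmoothField ξ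
  smooth_eta : ContMDiff I (I.prod 𝓘(ℝ, E →L[ℝ] ℝ)) ∞
    (fun x ↦ TotalSpace.mk' (E →L[ℝ] ℝ) (E := fun x : M ↦ TangentSpace I x →L[ℝ] Trivial M ℝ x)
      x (η x))
  phi_sq : ∀ (x : M) (u : TangentSpace I x), φ x (φ x u) = -u + η x u • ξ x
  eta_xi : ∀ x : M, η x (ξ x) = 1
  compatible : ∀ (x : M) (u v : TangentSpace I x),
    inner ℝ (φ x u) (φ x v) = inner ℝ u v - η x u * η x v

/-- Kenmotsu manifolds: almost contact metric manifolds with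
`(∇_X φ) Y = g(φ X, Y) ξ - η(Y) φ X`, where `(∇_X φ) Y = ∇_X (φ Y) - φ (∇_X Y)`. -/
structure IsKenmotsu (φ : Π x : M, TangentSpace I x →L[ℝ] TangentSpace I x)
    (ξ : Π x : M, TangentSpace I x) (η : Π x : M, TangentSpace I x →L[ℝ] ℝ) : Prop
    extends IsAlmostContactMetric φ ξ η where
  nabla_phi : ∀ X Y : Π x : M, TangentSpace I x, SmoothField X → SmoothField Y → ∀ x : M,
    nabla X (fun y ↦ φ y (Y y)) x - φ x (nabla X Y x)
      = (inner ℝ (φ x (X x)) (Y x) : ℝ) • ξ x - η x (Y x) • φ x (X x)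

/-- Almost `*`-Ricci solitons: `(1/2) L_V g + Ric^* = lam g` with `V` a smooth vector field and
`lam` a smooth function. -/
structure IsAlmostStarRicciSoliton (φ : Π x : M, TangentSpace I x →L[ℝ] TangentSpace I x)
    (V : Π x : M, TangentSpace I x) (lam : M → ℝ) : Prop where
  smooth_field : SmoothField V
  smooth_lam : ContMDiff I 𝓘(ℝ, ℝ) ∞ lam
  soliton : ∀ X Y : Π x : M, TangentSpace I x, SmoothField X → SmoothField Y → ∀ x : M,
    (1 / 2 : ℝ) * lieMetric V X Y x + starRicci φ x (X x) (Y x) = lam x * inner ℝ (X x) (Y x)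

/-- `V` is a Jacobi field along (the integral curves of) `ξ`:
`∇_ξ ∇_ξ V + R(V, ξ)ξ = 0`. -/
def IsJacobiAlong (ξ V : Π x : M, TangentSpace I x) : Prop :=
  ∀ x : M, nabla ξ (nabla ξ V) x + curv V ξ ξ x = 0

end Riem

end

/-! Write `f = η(V)` and `S = Ric^*`. On a Kenmotsu manifold `∇_X ξ = X - η(X)ξ`, hence `R(X,Y)ξ =
η(X)Y - η(Y)X`, and the second Bianchi identity gives `∇_ξ R = -2(R + R₁)` with `R₁(X,Y)Z = g(Y,Z)X
- g(X,Z)Y`. Since `∇_ξ φ = 0`, taking the trace yields `∇_ξ S = -2S - 2g(φ·,φ·)`.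

The Jacobi equation becomes `∇_ξ∇_ξ V = V - fξ`. As `φξ = 0`, also `S(ξ,ξ) = 0`, so the soliton
equation at `(ξ,ξ)` reads `ξ(f) = λ`, and a further derivative gives `ξ(λ) = 0`. On vectors
orthogonal to `ξ` one has `∇_ξ(L_U g) = 2η(U)g + L_{∇_ξ U} g - L_U g` (`nab_ξ_deform`). For `U = V`
this determines `L_{∇_ξ V} g`; for `U = ∇_ξ V` the Jacobi equation closes the system, and everything
cancels except `4λg = 0` (`soliton_steady`). A nonzero vector orthogonal to `ξ` exists because the
dimension exceeds one.

These computations use only formal rules, so they are done over a commutative ring of functions and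
a module of fields. The analytic work is to show that smooth functions and fields form such a model
(`leviCivita`) and that the pointwise trace defining `S` can be differentiated in a local
orthonormal frame (`IsKenmotsu.nabla_xi_starRicci`). -/

/-! ### Levi-Civita calculus over a commutative ring -/

/-- An algebraic model of a Riemannian manifold: a module `L` ("vector fields") over a commutative
ring `A` ("functions") with an action of `L` on `A` by derivations, a Lie bracket, a nondegenerate
metric and its Levi-Civita connection. -/
structure LeviCivitaAlgebra (A L : Type*) [CommRing A] [AddCommGroup L] [Module A L] where
  D : L →ₗ[A] (A →+ A)
  D_mul : ∀ X a b, D X (a * b) = D X a * b + a * D X b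
  br : L → L → L
  D_br : ∀ X Y a, D (br X Y) a = D X (D Y a) - D Y (D X a)
  jacobi : ∀ X Y Z, br X (br Y Z) = br (br X Y) Z + br Y (br X Z)
  g : L →ₗ[A] L →ₗ[A] A
  g_comm : ∀ X Y, g X Y = g Y X
  g_nondeg : ∀ X, (∀ Y, g X Y = 0) → X = 0
  nab : L →ₗ[A] (L →+ L)
  nab_smul : ∀ X (a : A) Y, nab X (a • Y) = D X a • Y + a • nab X Y
  nab_torsion : ∀ X Y, br X Y = nab X Y - nab Y X
  nab_metric : ∀ X Y Z, D X (g Y Z) = g (nab X Y) Z + g Y (nab X Z)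
  two_torsion : ∀ a : A, 2 * a = 0 → a = 0

namespace LeviCivitaAlgebra

variable {A L : Type*} [CommRing A] [AddCommGroup L] [Module A L] (C : LeviCivitaAlgebra A L)

theorem D_one (X : L) : C.D X 1 = 0 := by
  simpa using C.D_mul X 1 1

/-- The curvature operator. -/
def R (X Y Z : L) : L := C.nab X (C.nab Y Z) - C.nab Y (C.nab X Z) - C.nab (C.br X Y) Z

theorem R_swap (X Y Z : L) : C.R X Y Z = -C.R Y X Z := by
  simp only [R, C.nab_torsion, map_sub, AddMonoidHom.sub_apply]
  abel

theorem R_add_left (X X' Y Z : L) : C.R (X + X') Y Z = C.R X Y Z + C.R X' Y Z := by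
  simp only [R, C.nab_torsion, map_sub, map_add, AddMonoidHom.sub_apply, AddMonoidHom.add_apply]
  abel

theorem R_smul_left (a : A) (X Y Z : L) : C.R (a • X) Y Z = a • C.R X Y Z := by
  simp only [R, C.nab_torsion, map_sub, map_smul, AddMonoidHom.sub_apply, AddMonoidHom.add_apply,
    AddMonoidHom.smul_apply, C.nab_smul, map_add]
  module

theorem R_add_middle (X Y Y' Z : L) : C.R X (Y + Y') Z = C.R X Y Z + C.R X Y' Z := by
  rw [C.R_swap, R_add_left, C.R_swap Y, C.R_swap Y']
  abel

theorem R_smul_middle (a : A) (X Y Z : L) : C.R X (a • Y) Z = a • C.R X Y Z := by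
  rw [C.R_swap, R_smul_left, C.R_swap Y]
  module

theorem R_add_right (X Y Z Z' : L) : C.R X Y (Z + Z') = C.R X Y Z + C.R X Y Z' := by
  simp only [R, map_add]
  abel

theorem R_smul_right (a : A) (X Y Z : L) : C.R X Y (a • Z) = a • C.R X Y Z := by
  simp only [R, C.nab_smul, map_add, C.D_br]
  module

/-- The curvature as a trilinear map. -/
def Rlin : L →ₗ[A] L →ₗ[A] L →ₗ[A] L :=
  LinearMap.mk₂ A
    (fun X Y ↦
      { toFun := C.R X Y, map_add' := C.R_add_right X Y, map_smul' := fun a ↦ C.R_smul_right a X Y })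
    (fun X X' Y ↦ LinearMap.ext fun Z ↦ C.R_add_left X X' Y Z)
    (fun a X Y ↦ LinearMap.ext fun Z ↦ C.R_smul_left a X Y Z)
    (fun X Y Y' ↦ LinearMap.ext fun Z ↦ C.R_add_middle X Y Y' Z)
    (fun a X Y ↦ LinearMap.ext fun Z ↦ C.R_smul_middle a X Y Z)

theorem Rlin_apply (X Y Z : L) : C.Rlin X Y Z = C.R X Y Z := rfl

theorem bianchi_first (X Y Z : L) : C.R X Y Z + C.R Y Z X + C.R Z X Y = 0 := by
  have h := C.jacobi X Y Z
  simp only [C.nab_torsion, map_sub, AddMonoidHom.sub_apply] at h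
  simp only [R, C.nab_torsion, map_sub, AddMonoidHom.sub_apply]
  linear_combination (norm := module) h

theorem R_skew (X Y Z W : L) : C.g (C.R X Y Z) W = -C.g Z (C.R X Y W) := by
  have h := C.D_br X Y (C.g Z W)
  simp only [C.nab_metric, map_add] at h
  simp only [R, map_sub, LinearMap.sub_apply]
  linear_combination -h

/-- Four cyclic instances of the first Bianchi identity, combined with skewness in each pair, give
twice the difference of the two sides. -/
theorem R_pair (X Y Z W : L) : C.g (C.R X Y Z) W = C.g (C.R Z W X) Y := by
  have b (X Y Z W : L) : C.g (C.R X Y Z) W + C.g (C.R Y Z X) W + C.g (C.R Z X Y) W = 0 := by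
    simpa using congrArg (C.g · W) (C.bianchi_first X Y Z)
  have s (X Y Z W : L) : C.g (C.R X Y Z) W = -C.g (C.R X Y W) Z := by
    rw [C.R_skew, C.g_comm]
  have a (X Y Z W : L) : C.g (C.R X Y Z) W = -C.g (C.R Y X Z) W := by
    rw [C.R_swap]; simp
  apply sub_eq_zero.1
  apply C.two_torsion
  have h1 := b X Y Z W
  have h2 := b Y Z W X
  have h3 := b Z W X Y
  have h4 := b W X Y Z
  grind

/-- The covariant derivative of the curvature. -/
def nabR (W X Y Z : L) : L :=
  C.nab W (C.R X Y Z) - C.R (C.nab W X) Y Z - C.R X (C.nab W Y) Z - C.R X Y (C.nab W Z)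

/-- Once brackets are expanded by vanishing torsion, all terms cancel except `∇` along the Jacobi
identity of `W, X, Y`, applied to `Z`. -/
theorem bianchi_second (W X Y Z : L) :
    C.nabR W X Y Z + C.nabR X Y W Z + C.nabR Y W X Z = 0 := by
  have h : C.nab (C.br W (C.br X Y)) Z
      = C.nab (C.br (C.br W X) Y) Z + C.nab (C.br X (C.br W Y)) Z := by
    rw [C.jacobi]; simp
  simp only [C.nab_torsion, map_sub, AddMonoidHom.sub_apply] at h
  simp only [nabR, R, C.nab_torsion, map_sub, AddMonoidHom.sub_apply]
  linear_combination (norm := module) -h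

/-- The deformation tensor `L_U g` of a vector field. -/
def deform (U X Y : L) : A := C.g (C.nab X U) Y + C.g X (C.nab Y U)

end LeviCivitaAlgebra

/-! ### Kenmotsu identities and the steadiness computation -/

/-- The algebraic form of a Kenmotsu structure. -/
structure KenmotsuAlgebra (A L : Type*) [CommRing A] [AddCommGroup L] [Module A L] extends
    LeviCivitaAlgebra A L where
  φ : L →ₗ[A] L
  ξ : L
  φ_sq : ∀ X, φ (φ X) = -X + g X ξ • ξ
  g_ξ_ξ : g ξ ξ = 1
  φ_ξ : φ ξ = 0
  g_φ_ξ : ∀ X, g (φ X) ξ = 0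
  φ_skew : ∀ X Y, g (φ X) Y = -g X (φ Y)
  nab_φ : ∀ X Y, nab X (φ Y) = φ (nab X Y) + g (φ X) Y • ξ - g Y ξ • φ X

namespace KenmotsuAlgebra

variable {A L : Type*} [CommRing A] [AddCommGroup L] [Module A L] (K : KenmotsuAlgebra A L)

/-- The Kenmotsu condition with `Y = ξ` says `φ(∇_X ξ) = φX`. Applying `φ` again recovers `∇_X ξ` up
to its `ξ`-component, which vanishes because `ξ` has unit length. -/
theorem nab_ξ (X : L) : K.nab X K.ξ = X - K.g X K.ξ • K.ξ := by
  have h1 := K.nab_φ X K.ξ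
  have h2 : K.g (K.nab X K.ξ) K.ξ = 0 := by
    apply K.two_torsion
    have := K.nab_metric X K.ξ K.ξ
    rw [K.g_ξ_ξ, K.D_one, K.g_comm K.ξ] at this
    linear_combination -this
  rw [K.φ_ξ, map_zero, K.g_φ_ξ, K.g_ξ_ξ] at h1
  have h3 : K.φ (K.nab X K.ξ) = K.φ X := by linear_combination (norm := module) -h1
  have h4 := congrArg K.φ h3
  rw [K.φ_sq, K.φ_sq, h2] at h4
  linear_combination (norm := module) -h4

theorem nab_ξ_φ (Y : L) : K.nab K.ξ (K.φ Y) = K.φ (K.nab K.ξ Y) := by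
  rw [K.nab_φ, K.φ_ξ]; simp

theorem D_g_ξ (X Y : L) :
    K.D X (K.g Y K.ξ) = K.g (K.nab X Y) K.ξ + K.g X Y - K.g X K.ξ * K.g Y K.ξ := by
  rw [K.nab_metric, K.nab_ξ, K.g_comm X Y]
  simp
  ring

theorem D_ξ_g_ξ (Y : L) : K.D K.ξ (K.g Y K.ξ) = K.g (K.nab K.ξ Y) K.ξ := by
  rw [K.D_g_ξ, K.g_ξ_ξ, K.g_comm K.ξ]; simp

theorem R_ξ (X Y : L) : K.R X Y K.ξ = K.g X K.ξ • Y - K.g Y K.ξ • X := by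
  simp only [LeviCivitaAlgebra.R, K.nab_ξ, map_sub, K.nab_smul, K.D_g_ξ, K.nab_torsion,
    AddMonoidHom.sub_apply, K.g_comm Y X]
  module

/-- Pair symmetry moves `ξ` into the last slot of `R`, where `R_ξ` applies. -/
theorem R_right_ξ (X Z : L) : K.R X K.ξ Z = K.g X Z • K.ξ - K.g Z K.ξ • X := by
  apply sub_eq_zero.1
  apply K.g_nondeg
  intro W
  have h1 := K.R_pair X K.ξ Z W
  have h2 := K.R_skew Z W X K.ξ
  rw [K.R_ξ] at h2
  simp only [map_sub, map_smul, LinearMap.sub_apply, LinearMap.smul_apply, smul_eq_mul] at h2 ⊢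
  rw [h1, h2, K.g_comm K.ξ W]
  ring

/-- Differentiating the known tensor `R(·,ξ)·` leaves `R(X,Y)Z`, because `∇_X ξ = X - η(X)ξ` puts
`X` back into the slot of `ξ`. -/
theorem nabR_right_ξ (X Y Z : L) :
    K.nabR X Y K.ξ Z = K.g Y Z • X - K.g X Z • Y + K.R X Y Z := by
  simp only [LeviCivitaAlgebra.nabR, K.R_right_ξ]
  have h : K.R Y (K.nab X K.ξ) Z = K.R Y X Z - K.g X K.ξ • K.R Y K.ξ Z := by
    simp only [← K.Rlin_apply, K.nab_ξ, map_sub, map_smul, LinearMap.sub_apply,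
      LinearMap.smul_apply]
  rw [h, K.R_swap X Y, K.R_right_ξ]
  simp only [map_sub, K.nab_smul, K.nab_ξ, K.D_g_ξ, K.nab_metric]
  module

/-- The second Bianchi identity trades `∇_ξ R` for two derivatives with `ξ` in an argument slot,
both known from `nabR_right_ξ`. -/
theorem nabR_ξ (X Y Z : L) :
    K.nabR K.ξ X Y Z = -((2 : A) • (K.R X Y Z + K.g Y Z • X - K.g X Z • Y)) := by
  have h1 := K.bianchi_second K.ξ X Y Z
  have h2 : K.nabR Y K.ξ X Z = -K.nabR Y X K.ξ Z := by
    simp only [LeviCivitaAlgebra.nabR, K.R_swap K.ξ X, K.R_swap (K.nab Y K.ξ) X,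
      K.R_swap K.ξ (K.nab Y X), map_neg]
    abel
  rw [h2, K.nabR_right_ξ, K.nabR_right_ξ, K.R_swap Y X] at h1
  linear_combination (norm := module) h1

/-- One diagonal term of the trace for `2 Ric^*`, with `Z` a frame field. The last bracket is the
variation of the frame, which disappears only after summation. -/
theorem D_ξ_trace_term (X Y Z : L) :
    K.D K.ξ (K.g (K.φ (K.R X (K.φ Y) Z)) Z)
      = -2 * (K.g (K.φ (K.R X (K.φ Y) Z)) Z + K.g (K.φ Y) Z * K.g (K.φ X) Z
          - K.g X Z * K.g (K.φ (K.φ Y)) Z)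
        + K.g (K.φ (K.R (K.nab K.ξ X) (K.φ Y) Z)) Z + K.g (K.φ (K.R X (K.φ (K.nab K.ξ Y)) Z)) Z
        + (K.g (K.φ (K.R X (K.φ Y) (K.nab K.ξ Z))) Z
          + K.g (K.φ (K.R X (K.φ Y) Z)) (K.nab K.ξ Z)) := by
  have h := K.nabR_ξ X (K.φ Y) Z
  rw [LeviCivitaAlgebra.nabR, K.nab_ξ_φ, sub_eq_iff_eq_add, sub_eq_iff_eq_add,
    sub_eq_iff_eq_add] at h
  rw [K.nab_metric, K.nab_ξ_φ, h]
  simp only [map_add, map_sub, map_neg, map_smul, LinearMap.add_apply, LinearMap.sub_apply,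
    LinearMap.neg_apply, LinearMap.smul_apply, smul_eq_mul]
  ring

/-- For `X` orthogonal to `ξ`, `[X,ξ] = X - ∇_ξ X`; the formula for `R(X,ξ)U` then commutes `∇_ξ`
past `∇_X U`. -/
theorem nab_ξ_deform (U : L) {X Y : L} (hX : K.g X K.ξ = 0) (hY : K.g Y K.ξ = 0) :
    K.D K.ξ (K.deform U X Y) - K.deform U (K.nab K.ξ X) Y - K.deform U X (K.nab K.ξ Y)
      = 2 * K.g U K.ξ * K.g X Y + K.deform (K.nab K.ξ U) X Y - K.deform U X Y := by
  have key (X : L) (hX : K.g X K.ξ = 0) :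
      K.nab K.ξ (K.nab X U) = K.nab (K.nab K.ξ X) U + K.g U K.ξ • X - K.g X U • K.ξ
        + K.nab X (K.nab K.ξ U) - K.nab X U := by
    have h := K.R_right_ξ X U
    simp only [LeviCivitaAlgebra.R, K.nab_torsion, K.nab_ξ, hX, zero_smul, sub_zero, map_sub,
      AddMonoidHom.sub_apply] at h
    linear_combination (norm := module) -h
  simp only [LeviCivitaAlgebra.deform, map_add, K.nab_metric, key X hX, key Y hY, map_sub,
    LinearMap.add_apply, LinearMap.sub_apply, map_smul, LinearMap.smul_apply, smul_eq_mul,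
    K.g_comm K.ξ Y, hX, hY]
  ring

/-- `S` stands for `Ric^*`; only its value at `(ξ,ξ)` and its derivative along `ξ` matter, so no
trace is needed here. -/
theorem soliton_steady {V : L} {lam : A} {S : L → L → A}
    (hS : ∀ X Y, K.deform V X Y + 2 * S X Y = 2 * lam * K.g X Y)
    (hSξ : S K.ξ K.ξ = 0)
    (hD : ∀ X Y, K.D K.ξ (S X Y) - S (K.nab K.ξ X) Y - S X (K.nab K.ξ Y)
      = -2 * S X Y - 2 * K.g (K.φ X) (K.φ Y))
    (hJ : K.nab K.ξ (K.nab K.ξ V) + K.R V K.ξ K.ξ = 0)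
    {X Y : L} (hX : K.g X K.ξ = 0) (hY : K.g Y K.ξ = 0) : lam * K.g X Y = 0 := by
  have hg {X Y : L} (hY : K.g Y K.ξ = 0) : K.g (K.φ X) (K.φ Y) = K.g X Y := by
    rw [K.φ_skew, K.φ_sq, hY]; simp
  have hB : K.nab K.ξ (K.nab K.ξ V) = V - K.g V K.ξ • K.ξ := by
    rw [K.R_ξ, K.g_ξ_ξ] at hJ
    linear_combination (norm := module) hJ
  have hl : K.g (K.nab K.ξ V) K.ξ = lam := by
    apply sub_eq_zero.1
    apply K.two_torsion
    have := hS K.ξ K.ξ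
    simp only [LeviCivitaAlgebra.deform, K.g_comm K.ξ, hSξ, K.g_ξ_ξ] at this
    linear_combination this
  have hDl : K.D K.ξ lam = 0 := by
    rw [← hl, K.D_ξ_g_ξ, hB]
    simp [K.g_ξ_ξ]
  have hDf : K.D K.ξ (K.g V K.ξ) = lam := by rw [K.D_ξ_g_ξ, hl]
  have hn {X : L} (hX : K.g X K.ξ = 0) : K.g (K.nab K.ξ X) K.ξ = 0 := by
    rw [← K.D_ξ_g_ξ, hX, map_zero]
  -- First use of `nab_ξ_deform`, with `U = V`: replacing `L_V g` by `2λg - 2S` and using `ξ(λ) = 0`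
  -- solves for `L_{∇_ξ V} g`.
  have hDV {X Y : L} (hX : K.g X K.ξ = 0) (hY : K.g Y K.ξ = 0) :
      K.deform (K.nab K.ξ V) X Y = 2 * S X Y + (4 - 2 * K.g V K.ξ + 2 * lam) * K.g X Y := by
    have h1 := K.nab_ξ_deform V hX hY
    have e (X Y) : K.deform V X Y = lam * K.g X Y + lam * K.g X Y - (S X Y + S X Y) := by
      linear_combination hS X Y
    have h2 := hD X Y
    rw [hg hY] at h2
    simp only [e, map_sub, map_add, K.D_mul, hDl, K.nab_metric] at h1
    linear_combination -h1 - 2 * h2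
  -- On vectors orthogonal to `ξ` the differential of `f = η(V)` drops out, so `L_{fξ} g = 2f g`.
  have hW : K.deform (V - K.g V K.ξ • K.ξ) X Y
      = K.deform V X Y - 2 * K.g V K.ξ * K.g X Y := by
    simp only [LeviCivitaAlgebra.deform, map_sub, K.nab_smul, K.nab_ξ, hX, hY,
      K.g_comm K.ξ Y, LinearMap.sub_apply, map_add, map_smul, LinearMap.add_apply,
      LinearMap.smul_apply, smul_eq_mul]
    ring
  -- Second use, with `U = ∇_ξ V`; `∇_ξ U` is now `V - fξ` by the Jacobi equation.
  have h1 := K.nab_ξ_deform (K.nab K.ξ V) hX hY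
  have h2 := hD X Y
  have h3 := hS X Y
  have h5 : K.D K.ξ (4 : A) = 0 := by
    have : (4 : A) = 1 + 1 + 1 + 1 := by norm_num
    rw [this]
    simp only [map_add, K.D_one, add_zero]
  rw [hg hY] at h2
  rw [hB, hW, hl, hDV hX hY, hDV (hn hX) hY, hDV hX (hn hY)] at h1
  simp only [two_mul, map_sub, map_add, K.D_mul, hDl, hDf, h5, K.nab_metric] at h1
  -- The remaining relation is `4λ g(X,Y) = 0`.
  apply K.two_torsion
  apply K.two_torsion
  linear_combination -h1 + 2 * h2 - h3

end KenmotsuAlgebra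

/-! ### Global smooth fields, orthonormal frames and smoothness of the connection -/

noncomputable section

namespace Riem

variable {E : Type*} [NormedAddCommGroup E] [NormedSpace ℝ E] [FiniteDimensional ℝ E]
  {H : Type*} [TopologicalSpace H] {I : ModelWithCorners ℝ E H}
  {M : Type*} [TopologicalSpace M] [ChartedSpace H M] [IsManifold I ∞ M]

theorem SmoothField.mdifferentiableAt {X : Π x : M, TangentSpace I x} (hX : SmoothField X) (x : M) :
    MDiffAt (T% X) x :=
  ContMDiff.mdifferentiable hX (by simp) x

theorem contMDiff_dirDeriv {X : Π x : M, TangentSpace I x} {f : M → ℝ} (hX : SmoothField X)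
    (hf : ContMDiff I 𝓘(ℝ, ℝ) ∞ f) : ContMDiff I 𝓘(ℝ, ℝ) ∞ (dirDeriv X f) :=
  (contMDiff_snd_tangentBundle_modelSpace ℝ 𝓘(ℝ, ℝ)).comp
    ((hf.contMDiff_tangentMap (by simp)).comp hX)

theorem minSmoothness_le_infty (k : ℕ) : minSmoothness ℝ k ≤ ∞ := by
  simpa using by exact_mod_cast le_top

theorem isManifold_minSmoothness (k : ℕ) : IsManifold I (minSmoothness ℝ k) M :=
  IsManifold.of_le (n := ∞) (minSmoothness_le_infty k)

theorem SmoothField.mlieBracket {X Y : Π x : M, TangentSpace I x} (hX : SmoothField X)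
    (hY : SmoothField Y) : SmoothField (VectorField.mlieBracket I X Y) :=
  haveI : IsManifold I (minSmoothness ℝ 2) M := isManifold_minSmoothness 2
  haveI : IsManifold I (∞ + 1) M := ‹IsManifold I ∞ M›
  ContDiff.mlieBracket_vectorField (m := ⊤) (n := ⊤) hX hY (by simp)

/-- A field that is smooth on a neighbourhood of a point agrees near that point with a globally
smooth field. -/
theorem exists_smoothField_eventuallyEq [T2Space M] {x : M} {U : Set M} (hU : U ∈ 𝓝 x)
    {σ : Π x : M, TangentSpace I x} (hσ : CMDiff[U] ∞ (T% σ)) :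
    ∃ X : Π x : M, TangentSpace I x, SmoothField X ∧ ∀ᶠ y in 𝓝 x, X y = σ y := by
  obtain ⟨f, hf⟩ := (SmoothBumpFunction.nhds_basis_tsupport (I := I) x).mem_iff.1
    (interior_mem_nhds.2 hU)
  refine ⟨(f : M → ℝ) • σ, ?_, ?_⟩
  · exact ContMDiffOn.smul_section_of_tsupport f.contMDiff.contMDiffOn isOpen_interior hf.2
      (hσ.mono interior_subset)
  · filter_upwards [f.eventuallyEq_one] with y hy
    rw [Pi.smul_apply', hy, Pi.one_apply, one_smul]

theorem exists_smoothField_eventuallyEq_extend [T2Space M] {x : M} (u : TangentSpace I x) :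
    ∃ X : Π x : M, TangentSpace I x, SmoothField X ∧
      ∀ᶠ y in 𝓝 x, X y = FiberBundle.extend (E := fun x : M ↦ TangentSpace I x) E u y := by
  refine exists_smoothField_eventuallyEq
    ((trivializationAt E (TangentSpace I) x).open_baseSet.mem_nhds
      (FiberBundle.mem_baseSet_trivializationAt' x)) ?_
  rw [Trivialization.contMDiffOn_section_baseSet_iff]
  refine (contMDiffOn_const (c := (trivializationAt E (TangentSpace I) x ⟨x, u⟩).2)).congr ?_
  intro y hy
  rw [FiberBundle.extend, Trivialization.mk_symm _ hy, Trivialization.apply_symm_apply]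
  rw [Trivialization.mem_target]
  exact hy

variable [RiemannianBundle (fun x : M ↦ TangentSpace I x)]

theorem dirDeriv_congr {X X' : Π x : M, TangentSpace I x} {f f' : M → ℝ} {x : M}
    (hX : X x = X' x) (hf : f =ᶠ[𝓝 x] f') : dirDeriv X f x = dirDeriv X' f' x := by
  simp only [dirDeriv, mvfderiv, ContinuousLinearMap.comp_apply]
  rw [hX, hf.mfderiv_eq]
  rfl

section
variable [IsContMDiffRiemannianBundle I ∞ E (fun x : M ↦ TangentSpace I x)]

theorem contMDiff_gm {X Y : Π x : M, TangentSpace I x} (hX : SmoothField X)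
    (hY : SmoothField Y) : ContMDiff I 𝓘(ℝ, ℝ) ∞ (gm X Y) :=
  ContMDiff.inner_bundle (IM := I) (IB := I) (F := E) (E := fun x : M ↦ TangentSpace I x)
    (b := fun x ↦ x) hX hY

theorem contMDiff_koszul {X Y Z : Π x : M, TangentSpace I x} (hX : SmoothField X)
    (hY : SmoothField Y) (hZ : SmoothField Z) : ContMDiff I 𝓘(ℝ, ℝ) ∞ (koszul X Y Z) :=
  (((((contMDiff_dirDeriv hX (contMDiff_gm hY hZ)).add
    (contMDiff_dirDeriv hY (contMDiff_gm hX hZ))).sub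
    (contMDiff_dirDeriv hZ (contMDiff_gm hX hY))).add
    (contMDiff_gm (hX.mlieBracket hY) hZ)).sub
    (contMDiff_gm (hX.mlieBracket hZ) hY)).sub
    (contMDiff_gm (hY.mlieBracket hZ) hX)

theorem contMDiffOn_inner {U : Set M} {X Y : Π x : M, TangentSpace I x} (hX : CMDiff[U] ∞ (T% X))
    (hY : CMDiff[U] ∞ (T% Y)) : CMDiff[U] ∞ (fun y ↦ (inner ℝ (X y) (Y y) : ℝ)) :=
  ContMDiffOn.inner_bundle (IM := I) (IB := I) (F := E) (E := fun x : M ↦ TangentSpace I x)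
    (b := fun x ↦ x) hX hY

/-- Gram–Schmidt orthogonalization preserves smoothness of frames. -/
theorem contMDiffOn_gramSchmidt {n : ℕ} {U : Set M} {s : Fin n → Π x : M, TangentSpace I x}
    (hs : ∀ i, CMDiff[U] ∞ (T% (s i))) (hli : ∀ y ∈ U, LinearIndependent ℝ (fun i ↦ s i y))
    (i : Fin n) :
    CMDiff[U] ∞ (T% (fun y ↦ InnerProductSpace.gramSchmidt ℝ (fun j ↦ s j y) i)) := by
  induction i using WellFoundedLT.induction with
  | ind i ih =>
    have h : (fun y ↦ InnerProductSpace.gramSchmidt ℝ (fun j ↦ s j y) i)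
        = s i - fun y ↦ ∑ j ∈ Finset.Iio i,
          ((fun y ↦ inner ℝ (InnerProductSpace.gramSchmidt ℝ (fun j ↦ s j y) j) (s i y)
            / inner ℝ (InnerProductSpace.gramSchmidt ℝ (fun j ↦ s j y) j)
              (InnerProductSpace.gramSchmidt ℝ (fun j ↦ s j y) j) : M → ℝ) •
            (fun y ↦ InnerProductSpace.gramSchmidt ℝ (fun j ↦ s j y) j)) y := by
      funext y
      have := InnerProductSpace.gramSchmidt_def'' ℝ (fun j ↦ s j y) i
      simp only [Pi.sub_apply, Pi.smul_apply']
      rw [eq_sub_iff_add_eq]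
      simp only [real_inner_self_eq_norm_sq]
      exact this.symm
    refine ((hs i).sub_section (ContMDiffOn.sum_section fun j hj ↦ ?_)).congr
      fun y _ ↦ congrArg (TotalSpace.mk y) (congrFun h y)
    have hj := ih j (Finset.mem_Iio.1 hj)
    refine ContMDiffOn.smul_section ?_ hj
    refine (contMDiffOn_inner hj (hs i)).div₀ (contMDiffOn_inner hj hj) fun y hy ↦ ?_
    exact inner_self_ne_zero.2 (InnerProductSpace.gramSchmidt_ne_zero _ (hli y hy))

/-- Near every point there is an orthonormal frame consisting of globally smooth fields. -/
theorem exists_orthonormal_frame [T2Space M] (x : M) :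
    ∃ e : Fin (finrank ℝ E) → Π x : M, TangentSpace I x, (∀ i, SmoothField (e i)) ∧
      ∀ᶠ y in 𝓝 x, Orthonormal ℝ (fun i ↦ e i y) := by
  set t := trivializationAt E (TangentSpace I) x
  have ht : t.baseSet ∈ 𝓝 x :=
    t.open_baseSet.mem_nhds (FiberBundle.mem_baseSet_trivializationAt' x)
  set s := t.localFrame (finBasis ℝ E)
  have hs := t.isLocalFrameOn_localFrame_baseSet I ∞ (finBasis ℝ E)
  have hg := contMDiffOn_gramSchmidt (fun i ↦ hs.contMDiffOn i)
    (fun y hy ↦ hs.linearIndependent hy)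
  have hn (i) : CMDiff[t.baseSet] ∞
      (T% (fun y ↦ InnerProductSpace.gramSchmidtNormed ℝ (fun j ↦ s j y) i)) := by
    refine ContMDiffOn.smul_section (f := fun y ↦
      ‖InnerProductSpace.gramSchmidt ℝ (fun j ↦ s j y) i‖⁻¹) ?_ (hg i)
    have h0 (y) (hy : y ∈ t.baseSet) : InnerProductSpace.gramSchmidt ℝ (fun j ↦ s j y) i ≠ 0 :=
      InnerProductSpace.gramSchmidt_ne_zero _ (hs.linearIndependent hy)
    refine ContMDiffOn.inv₀ ?_ fun y hy ↦ norm_ne_zero_iff.2 (h0 y hy)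
    have := contMDiffOn_inner (hg i) (hg i)
    intro y hy
    have h1 : ContDiffAt ℝ ∞ Real.sqrt (inner ℝ (InnerProductSpace.gramSchmidt ℝ (fun j ↦ s j y) i)
        (InnerProductSpace.gramSchmidt ℝ (fun j ↦ s j y) i)) :=
      Real.contDiffAt_sqrt (inner_self_ne_zero.2 (h0 y hy))
    refine (h1.contMDiffAt.comp_contMDiffWithinAt y (this y hy)).congr_of_eventuallyEq ?_ ?_
    · filter_upwards with z
      rw [norm_eq_sqrt_real_inner]
      rfl
    · rw [norm_eq_sqrt_real_inner]
      rfl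
  choose e he hee using fun i ↦ exists_smoothField_eventuallyEq ht (hn i)
  refine ⟨e, he, ?_⟩
  filter_upwards [Filter.eventually_all.2 hee, ht] with y hy hyt
  simp only [hy]
  exact InnerProductSpace.gramSchmidtNormed_orthonormal (hs.linearIndependent hyt)

/-- The orthonormal basis of a tangent space given by the values of an orthonormal frame. -/
def frameBasis {x : M} {v : Fin (finrank ℝ E) → TangentSpace I x} (hv : Orthonormal ℝ v) :
    OrthonormalBasis (Fin (finrank ℝ E)) ℝ (TangentSpace I x) :=
  OrthonormalBasis.mk hv (by
    have : finrank ℝ (TangentSpace I x) = finrank ℝ E := rfl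
    rw [hv.linearIndependent.span_eq_top_of_card_eq_finrank' (by simp [this])])

theorem frameBasis_apply {x : M} {v : Fin (finrank ℝ E) → TangentSpace I x}
    (hv : Orthonormal ℝ v) (i) : frameBasis hv i = v i := by
  simp [frameBasis]

/-- The basis in the definition of `nabla` need not vary continuously with the point. The Koszul
formula allows it to be replaced near `x` by a smooth orthonormal frame, in which the coefficients
are smooth. -/
theorem SmoothField.nabla [T2Space M] {X Y : Π x : M, TangentSpace I x} (hX : SmoothField X)
    (hY : SmoothField Y) : SmoothField (nabla X Y) := by
  intro x
  obtain ⟨e, he, heo⟩ := exists_orthonormal_frame (I := I) x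
  have h : SmoothField (I := I) (M := M) (fun y ↦ ∑ i, (((1 / 2 : ℝ) • koszul X Y (e i)) • e i) y) :=
    ContMDiff.sum_section fun i _ ↦ ContMDiff.smul_section
      (ContMDiff.mul contMDiff_const (contMDiff_koszul hX hY (he i))) (he i)
  refine (h x).congr_of_eventuallyEq ?_
  filter_upwards [heo] with y hy
  congr 1
  rw [← (frameBasis hy).sum_repr' (Riem.nabla X Y y)]
  refine Finset.sum_congr rfl fun i _ ↦ ?_
  rw [Pi.smul_apply', Pi.smul_apply, frameBasis_apply, real_inner_comm, smul_eq_mul,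
    ← two_mul_inner_nabla (hX.mdifferentiableAt y) (hY.mdifferentiableAt y)
      ((he i).mdifferentiableAt y)]
  ring_nf

end
end Riem
end

/-! ### Rules for the bracket and the connection on smooth fields -/

noncomputable section

namespace Riem

variable {E : Type*} [NormedAddCommGroup E] [NormedSpace ℝ E] [FiniteDimensional ℝ E]
  {H : Type*} [TopologicalSpace H] {I : ModelWithCorners ℝ E H}
  {M : Type*} [TopologicalSpace M] [ChartedSpace H M] [IsManifold I ∞ M]

theorem exists_smoothField_apply_eq [T2Space M] {x : M} (u : TangentSpace I x) :
    ∃ X : Π x : M, TangentSpace I x, SmoothField X ∧ X x = u := by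
  obtain ⟨X, hX, h⟩ := exists_smoothField_eventuallyEq_extend u
  exact ⟨X, hX, by rw [h.self_of_nhds, FiberBundle.extend_apply_self]⟩

theorem mlieBracket_smul_right_eq {X Y : Π x : M, TangentSpace I x} {f : M → ℝ}
    (hY : SmoothField Y) (hf : ContMDiff I 𝓘(ℝ, ℝ) ∞ f) :
    VectorField.mlieBracket I X (f • Y) = dirDeriv X f • Y + f • VectorField.mlieBracket I X Y :=
  funext fun x ↦ VectorField.mlieBracket_smul_right (hf.mdifferentiable (by simp) x)
    (hY.mdifferentiableAt x)

theorem SmoothField.smul {X : Π x : M, TangentSpace I x} {f : M → ℝ}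
    (hX : SmoothField X) (hf : ContMDiff I 𝓘(ℝ, ℝ) ∞ f) : SmoothField (f • X) :=
  ContMDiff.smul_section hf hX

theorem mlieBracket_jacobi {X Y Z : Π x : M, TangentSpace I x} (hX : SmoothField X)
    (hY : SmoothField Y) (hZ : SmoothField Z) (x : M) :
    VectorField.mlieBracket I X (VectorField.mlieBracket I Y Z) x =
      VectorField.mlieBracket I (VectorField.mlieBracket I X Y) Z x +
      VectorField.mlieBracket I Y (VectorField.mlieBracket I X Z) x :=
  haveI : IsManifold I (minSmoothness ℝ 3) M := isManifold_minSmoothness 3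
  have h : minSmoothness ℝ 2 ≤ ∞ := minSmoothness_le_infty 2
  VectorField.leibniz_identity_mlieBracket_apply ((hX x).of_le h) ((hY x).of_le h)
    ((hZ x).of_le h)

theorem mlieBracket_add_right_eq {X Y Z : Π x : M, TangentSpace I x}
    (hY : SmoothField Y) (hZ : SmoothField Z) :
    VectorField.mlieBracket I X (Y + Z)
      = VectorField.mlieBracket I X Y + VectorField.mlieBracket I X Z :=
  funext fun x ↦ VectorField.mlieBracket_add_right
    (hY.mdifferentiableAt x) (hZ.mdifferentiableAt x)

/-- Expanding the Jacobi identity for `X, Y, fZ` and subtracting `f` times the one for `X, Y, Z`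
leaves the difference of the two sides as a coefficient of `Z`. -/
theorem dirDeriv_mlieBracket [T2Space M] {X Y : Π x : M, TangentSpace I x} {f : M → ℝ}
    (hX : SmoothField X) (hY : SmoothField Y) (hf : ContMDiff I 𝓘(ℝ, ℝ) ∞ f) (x : M) :
    dirDeriv (VectorField.mlieBracket I X Y) f x
      = dirDeriv X (dirDeriv Y f) x - dirDeriv Y (dirDeriv X f) x := by
  -- Reading off that coefficient requires `Z x ≠ 0`; over a zero tangent space all derivatives
  -- vanish.
  rcases subsingleton_or_nontrivial (TangentSpace I x) with hs | hn
  · have h0 (W : Π x : M, TangentSpace I x) (f : M → ℝ) : dirDeriv W f x = 0 := by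
      rw [dirDeriv, Subsingleton.elim (W x) 0, map_zero]
    simp [h0]
  obtain ⟨u, hu⟩ := exists_ne (0 : TangentSpace I x)
  obtain ⟨Z, hZ, rfl⟩ := exists_smoothField_apply_eq u
  have hXf := contMDiff_dirDeriv hX hf
  have hYf := contMDiff_dirDeriv hY hf
  have key := mlieBracket_jacobi hX hY (hZ.smul hf) x
  have key' := mlieBracket_jacobi hX hY hZ x
  rw [mlieBracket_smul_right_eq hZ hf, mlieBracket_smul_right_eq hZ hf,
    mlieBracket_smul_right_eq hZ hf,
    mlieBracket_add_right_eq (hZ.smul hYf) ((hY.mlieBracket hZ).smul hf),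
    mlieBracket_add_right_eq (hZ.smul hXf) ((hX.mlieBracket hZ).smul hf),
    mlieBracket_smul_right_eq hZ hYf, mlieBracket_smul_right_eq hZ hXf,
    mlieBracket_smul_right_eq (hX.mlieBracket hZ) hf,
    mlieBracket_smul_right_eq (hY.mlieBracket hZ) hf] at key
  simp only [Pi.add_apply, Pi.smul_apply', key'] at key
  have h : (dirDeriv (VectorField.mlieBracket I X Y) f x
      - (dirDeriv X (dirDeriv Y f) x - dirDeriv Y (dirDeriv X f) x)) • Z x = 0 := by
    linear_combination (norm := module) -key
  exact sub_eq_zero.1 ((smul_eq_zero.1 h).resolve_right hu)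

variable [RiemannianBundle (fun x : M ↦ TangentSpace I x)]

section
variable [IsContMDiffRiemannianBundle I ∞ E (fun x : M ↦ TangentSpace I x)]

theorem koszul_congr {X X' Y Y' Z Z' : Π x : M, TangentSpace I x} {x : M}
    (hX : ∀ᶠ y in 𝓝 x, X y = X' y) (hY : ∀ᶠ y in 𝓝 x, Y y = Y' y)
    (hZ : ∀ᶠ y in 𝓝 x, Z y = Z' y) : koszul X Y Z x = koszul X' Y' Z' x := by
  have g {X X' Y Y' : Π x : M, TangentSpace I x} (hX : ∀ᶠ y in 𝓝 x, X y = X' y)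
      (hY : ∀ᶠ y in 𝓝 x, Y y = Y' y) : gm X Y =ᶠ[𝓝 x] gm X' Y' := by
    filter_upwards [hX, hY] with y h1 h2
    simp [gm, h1, h2]
  have b {X X' Y Y' : Π x : M, TangentSpace I x} (hX : ∀ᶠ y in 𝓝 x, X y = X' y)
      (hY : ∀ᶠ y in 𝓝 x, Y y = Y' y) :
      VectorField.mlieBracket I X Y x = VectorField.mlieBracket I X' Y' x :=
    Filter.EventuallyEq.mlieBracket_vectorField_eq hX hY
  simp only [koszul]
  rw [dirDeriv_congr hX.self_of_nhds (g hY hZ), dirDeriv_congr hY.self_of_nhds (g hX hZ),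
    dirDeriv_congr hZ.self_of_nhds (g hX hY), b hX hY, b hX hZ, b hY hZ, hX.self_of_nhds,
    hY.self_of_nhds, hZ.self_of_nhds]

theorem nabla_congr {X X' Y Y' : Π x : M, TangentSpace I x} {x : M}
    (hX : ∀ᶠ y in 𝓝 x, X y = X' y) (hY : ∀ᶠ y in 𝓝 x, Y y = Y' y) :
    nabla X Y x = nabla X' Y' x := by
  simp only [nabla]
  refine Finset.sum_congr rfl fun i _ ↦ ?_
  rw [koszul_congr hX hY (Filter.Eventually.of_forall fun _ ↦ rfl)]

theorem eventually_nabla_congr {X X' Y Y' : Π x : M, TangentSpace I x} {x : M}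
    (hX : ∀ᶠ y in 𝓝 x, X y = X' y) (hY : ∀ᶠ y in 𝓝 x, Y y = Y' y) :
    ∀ᶠ y in 𝓝 x, nabla X Y y = nabla X' Y' y := by
  filter_upwards [hX.eventually_nhds, hY.eventually_nhds] with y h1 h2 using nabla_congr h1 h2

theorem curv_congr {X X' Y Y' Z Z' : Π x : M, TangentSpace I x} {x : M}
    (hX : ∀ᶠ y in 𝓝 x, X y = X' y) (hY : ∀ᶠ y in 𝓝 x, Y y = Y' y)
    (hZ : ∀ᶠ y in 𝓝 x, Z y = Z' y) : curv X Y Z x = curv X' Y' Z' x := by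
  have b : ∀ᶠ y in 𝓝 x, VectorField.mlieBracket I X Y y = VectorField.mlieBracket I X' Y' y :=
    Filter.EventuallyEq.mlieBracket_vectorField hX hY
  rw [curv, curv, nabla_congr hX (eventually_nabla_congr hY hZ),
    nabla_congr hY (eventually_nabla_congr hX hZ), nabla_congr b hZ]

theorem eq_of_forall_inner [T2Space M] {x : M} {u v : TangentSpace I x}
    (h : ∀ Z : Π x : M, TangentSpace I x, SmoothField Z →
      2 * inner ℝ u (Z x) = 2 * (inner ℝ v (Z x) : ℝ)) : u = v := by
  refine ext_inner_right ℝ fun w ↦ ?_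
  obtain ⟨Z, hZ, rfl⟩ := exists_smoothField_apply_eq w
  linarith [h Z hZ]

theorem dirDeriv_mul {X : Π x : M, TangentSpace I x} {f h : M → ℝ}
    (hf : ContMDiff I 𝓘(ℝ, ℝ) ∞ f) (hh : ContMDiff I 𝓘(ℝ, ℝ) ∞ h) (x : M) :
    dirDeriv X (fun y ↦ f y * h y) x = dirDeriv X f x * h x + f x * dirDeriv X h x := by
  have := mvfderiv_fun_mul (hf.mdifferentiable (by simp) x) (hh.mdifferentiable (by simp) x)
  rw [dirDeriv, this]
  simp [dirDeriv]
  ring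

theorem dirDeriv_add {X : Π x : M, TangentSpace I x} {f h : M → ℝ}
    (hf : ContMDiff I 𝓘(ℝ, ℝ) ∞ f) (hh : ContMDiff I 𝓘(ℝ, ℝ) ∞ h) (x : M) :
    dirDeriv X (fun y ↦ f y + h y) x = dirDeriv X f x + dirDeriv X h x := by
  have := mvfderiv_fun_add (hf.mdifferentiable (by simp) x) (hh.mdifferentiable (by simp) x)
  rw [dirDeriv, this]
  simp [dirDeriv]

theorem nabla_add_left [T2Space M] {X X' Y : Π x : M, TangentSpace I x} (hX : SmoothField X)
    (hX' : SmoothField X') (hY : SmoothField Y) (x : M) :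
    nabla (X + X') Y x = nabla X Y x + nabla X' Y x := by
  refine eq_of_forall_inner fun Z hZ ↦ ?_
  have hXX : SmoothField (X + X') := ContMDiff.add_section hX hX'
  rw [inner_add_left, mul_add, two_mul_inner_nabla (hX.mdifferentiableAt x)
    (hY.mdifferentiableAt x) (hZ.mdifferentiableAt x), two_mul_inner_nabla
    (hX'.mdifferentiableAt x) (hY.mdifferentiableAt x) (hZ.mdifferentiableAt x),
    two_mul_inner_nabla (hXX.mdifferentiableAt x) (hY.mdifferentiableAt x)
    (hZ.mdifferentiableAt x)]
  have e (W : Π x : M, TangentSpace I x) : gm (X + X') W = fun y ↦ gm X W y + gm X' W y := by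
    funext y; simp [gm, inner_add_left]
  simp only [koszul, e]
  rw [dirDeriv_add (contMDiff_gm hX hZ) (contMDiff_gm hX' hZ),
    dirDeriv_add (contMDiff_gm hX hY) (contMDiff_gm hX' hY),
    VectorField.mlieBracket_add_left (hX.mdifferentiableAt x) (hX'.mdifferentiableAt x),
    VectorField.mlieBracket_add_left (hX.mdifferentiableAt x) (hX'.mdifferentiableAt x)]
  simp only [dirDeriv, Pi.add_apply, map_add, inner_add_left, inner_add_right]
  ring

theorem nabla_smul_left [T2Space M] {X Y : Π x : M, TangentSpace I x} {f : M → ℝ}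
    (hX : SmoothField X) (hf : ContMDiff I 𝓘(ℝ, ℝ) ∞ f) (hY : SmoothField Y) (x : M) :
    nabla (f • X) Y x = f x • nabla X Y x := by
  refine eq_of_forall_inner fun Z hZ ↦ ?_
  have hfx := hf.mdifferentiable (by simp) x
  rw [real_inner_smul_left, mul_left_comm, two_mul_inner_nabla (hX.mdifferentiableAt x)
    (hY.mdifferentiableAt x) (hZ.mdifferentiableAt x),
    two_mul_inner_nabla ((hX.smul hf).mdifferentiableAt x) (hY.mdifferentiableAt x)
    (hZ.mdifferentiableAt x)]
  have e (W : Π x : M, TangentSpace I x) : gm (f • X) W = fun y ↦ f y * gm X W y := by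
    funext y; simp [gm, real_inner_smul_left]
  simp only [koszul, e]
  rw [dirDeriv_mul hf (contMDiff_gm hX hZ), dirDeriv_mul hf (contMDiff_gm hX hY),
    VectorField.mlieBracket_smul_left hfx (hX.mdifferentiableAt x),
    VectorField.mlieBracket_smul_left hfx (hX.mdifferentiableAt x)]
  simp only [dirDeriv, Pi.smul_apply', map_smul, inner_add_left, real_inner_smul_left,
    real_inner_smul_right, gm, smul_eq_mul, real_inner_comm (Y x) (X x),
    real_inner_comm (Z x) (X x)]
  ring

theorem nabla_eq_nabla_swap_add {X Y : Π x : M, TangentSpace I x} (hX : SmoothField X)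
    (hY : SmoothField Y) (x : M) :
    nabla X Y x = nabla Y X x + VectorField.mlieBracket I X Y x := by
  rw [← nabla_torsion_free (hX.mdifferentiableAt x) (hY.mdifferentiableAt x)]
  abel

/-- Vanishing torsion reduces the second argument to the first, up to a bracket; `nabla_smul_right`
is obtained in the same way. -/
theorem nabla_add_right [T2Space M] {X Y Y' : Π x : M, TangentSpace I x} (hX : SmoothField X)
    (hY : SmoothField Y) (hY' : SmoothField Y') (x : M) :
    nabla X (Y + Y') x = nabla X Y x + nabla X Y' x := by
  rw [nabla_eq_nabla_swap_add hX (ContMDiff.add_section hY hY'), nabla_add_left hY hY' hX,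
    mlieBracket_add_right_eq hY hY', nabla_eq_nabla_swap_add hX hY,
    nabla_eq_nabla_swap_add hX hY', Pi.add_apply]
  abel

theorem nabla_smul_right [T2Space M] {X Y : Π x : M, TangentSpace I x} {f : M → ℝ}
    (hX : SmoothField X) (hY : SmoothField Y) (hf : ContMDiff I 𝓘(ℝ, ℝ) ∞ f) (x : M) :
    nabla X (f • Y) x = dirDeriv X f x • Y x + f x • nabla X Y x := by
  rw [nabla_eq_nabla_swap_add hX (hY.smul hf), nabla_smul_left hY hf hX,
    mlieBracket_smul_right_eq hY hf, nabla_eq_nabla_swap_add hX hY, Pi.add_apply,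
    Pi.smul_apply', Pi.smul_apply']
  module

end

/-! ### The algebraic model of a Riemannian manifold -/

/-- Smooth real functions on `M`. -/
abbrev SmoothFun (I : ModelWithCorners ℝ E H) (M : Type*) [TopologicalSpace M]
    [ChartedSpace H M] := C^∞⟮I, M; 𝓘(ℝ, ℝ), ℝ⟯

/-- Bundled smooth vector fields on `M`. -/
abbrev Field (I : ModelWithCorners ℝ E H) (M : Type*) [TopologicalSpace M]
    [ChartedSpace H M] [IsManifold I ∞ M] := Cₛ^∞⟮I; E, fun x : M ↦ TangentSpace I x⟯

instance : SMul (SmoothFun I M) (Field I M) :=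
  ⟨fun f X ↦ ⟨(f : M → ℝ) • X, ContMDiff.smul_section f.contMDiff X.contMDiff⟩⟩

theorem Field.smul_apply (f : SmoothFun I M) (X : Field I M) (x : M) : (f • X) x = f x • X x := rfl

theorem Field.add_apply (X Y : Field I M) (x : M) : (X + Y) x = X x + Y x := rfl

theorem Field.smooth (X : Field I M) : SmoothField (fun x ↦ X x) := X.contMDiff

instance : Module (SmoothFun I M) (Field I M) where
  one_smul X := by ext x; exact one_smul ℝ (X x)
  mul_smul f h X := by ext x; exact mul_smul (f x) (h x) (X x)
  smul_zero f := by ext x; exact smul_zero (f x)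
  smul_add f X Y := by ext x; exact smul_add (f x) (X x) (Y x)
  add_smul f h X := by ext x; exact add_smul (f x) (h x) (X x)
  zero_smul X := by ext x; exact zero_smul ℝ (X x)

variable [IsContMDiffRiemannianBundle I ∞ E (fun x : M ↦ TangentSpace I x)]

variable (I M) in
/-- The algebraic model attached to a Riemannian manifold. -/
def leviCivita [T2Space M] : LeviCivitaAlgebra (SmoothFun I M) (Field I M) where
  D :=
    { toFun := fun X ↦
        AddMonoidHom.mk'
          (fun f ↦ ⟨dirDeriv (fun x ↦ X x) f, contMDiff_dirDeriv X.smooth f.contMDiff⟩)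
          (fun f h ↦ by ext x; exact dirDeriv_add f.contMDiff h.contMDiff x)
      map_add' := fun X Y ↦ by ext f x; exact (mvfderiv I (f : M → ℝ) x).map_add (X x) (Y x)
      map_smul' := fun f X ↦ by ext h x; exact (mvfderiv I (h : M → ℝ) x).map_smul (f x) (X x) }
  D_mul X f h := by ext x; exact dirDeriv_mul f.contMDiff h.contMDiff x
  br X Y := ⟨VectorField.mlieBracket I (fun x ↦ X x) (fun x ↦ Y x), X.smooth.mlieBracket Y.smooth⟩
  D_br X Y f := by ext x; exact dirDeriv_mlieBracket X.smooth Y.smooth f.contMDiff x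
  jacobi X Y Z := by ext x; exact mlieBracket_jacobi X.smooth Y.smooth Z.smooth x
  g := LinearMap.mk₂ _ (fun X Y ↦ ⟨gm (fun x ↦ X x) (fun x ↦ Y x), contMDiff_gm X.smooth Y.smooth⟩)
    (fun X X' Y ↦ by ext x; exact inner_add_left (X x) (X' x) (Y x))
    (fun f X Y ↦ by ext x; exact real_inner_smul_left (X x) (Y x) (f x))
    (fun X Y Y' ↦ by ext x; exact inner_add_right (X x) (Y x) (Y' x))
    (fun f X Y ↦ by ext x; exact real_inner_smul_right (X x) (Y x) (f x))
  g_comm X Y := by ext x; exact real_inner_comm (Y x) (X x)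
  g_nondeg X h := by
    ext x
    exact inner_self_eq_zero.1 (congrArg (fun f : SmoothFun I M ↦ f x) (h X) : _)
  nab :=
    { toFun := fun X ↦
        AddMonoidHom.mk' (fun Y ↦ ⟨nabla (fun x ↦ X x) (fun x ↦ Y x), X.smooth.nabla Y.smooth⟩)
          (fun Y Y' ↦ by ext x; exact nabla_add_right X.smooth Y.smooth Y'.smooth x)
      map_add' := fun X X' ↦ by
        ext Y x; exact nabla_add_left X.smooth X'.smooth Y.smooth x
      map_smul' := fun f X ↦ by
        ext Y x; exact nabla_smul_left X.smooth f.contMDiff Y.smooth x }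
  nab_smul X f Y := by ext x; exact nabla_smul_right X.smooth Y.smooth f.contMDiff x
  nab_torsion X Y := by
    ext x
    exact (nabla_torsion_free (X.smooth.mdifferentiableAt x) (Y.smooth.mdifferentiableAt x)).symm
  nab_metric X Y Z := by
    ext x
    exact nabla_metric (X.smooth.mdifferentiableAt x) (Y.smooth.mdifferentiableAt x)
      (Z.smooth.mdifferentiableAt x)
  two_torsion f h := by
    ext x
    rw [two_mul] at h
    have : f x + f x = 0 := congrArg (fun f : SmoothFun I M ↦ f x) h
    exact self_eq_neg.1 (eq_neg_of_add_eq_zero_left this)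

end Riem
end

/-! ### Tensoriality and traces in local frames -/

noncomputable section

namespace Riem

variable {E : Type*} [NormedAddCommGroup E] [NormedSpace ℝ E] [FiniteDimensional ℝ E]
  {H : Type*} [TopologicalSpace H] {I : ModelWithCorners ℝ E H}
  {M : Type*} [TopologicalSpace M] [ChartedSpace H M] [IsManifold I ∞ M]
  [RiemannianBundle (fun x : M ↦ TangentSpace I x)]
  [IsContMDiffRiemannianBundle I ∞ E (fun x : M ↦ TangentSpace I x)] [T2Space M]

theorem Field.exists_apply_eq {x : M} (u : TangentSpace I x) : ∃ X : Field I M, X x = u := by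
  obtain ⟨X, hX, h⟩ := exists_smoothField_apply_eq u
  exact ⟨⟨X, hX⟩, h⟩

theorem Field.exists_orthonormal_frame (x : M) :
    ∃ e : Fin (finrank ℝ E) → Field I M, ∀ᶠ y in 𝓝 x, Orthonormal ℝ (fun i ↦ e i y) := by
  obtain ⟨e, he, h⟩ := Riem.exists_orthonormal_frame (I := I) x
  exact ⟨fun i ↦ ⟨e i, he i⟩, h⟩

theorem Field.sum_apply {ι : Type*} (s : Finset ι) (X : ι → Field I M) (x : M) :
    (∑ i ∈ s, X i) x = ∑ i ∈ s, X i x :=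
  map_sum ((Pi.evalAddMonoidHom _ x).comp (ContMDiffSection.coeAddHom I E ∞ _)) X s

/-- A function-linear operation on fields only depends on the value of the field. -/
theorem linear_apply_eq_zero (T : Field I M →ₗ[SmoothFun I M] Field I M) {x : M} {X : Field I M}
    (hX : X x = 0) : T X x = 0 := by
  obtain ⟨e, he⟩ := Field.exists_orthonormal_frame (I := I) x
  obtain ⟨f, hf⟩ := (SmoothBumpFunction.nhds_basis_tsupport (I := I) x).mem_iff.1 he
  let c : SmoothFun I M := ⟨f, f.contMDiff⟩
  -- The bump `c` is supported where the frame is orthonormal, so this expansion is global, with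
  -- smooth coefficients that vanish at `x`.
  have h1 : c • X = ∑ i, (c * (leviCivita I M).g (e i) X) • e i := by
    ext y
    rw [Field.sum_apply]
    simp only [Field.smul_apply]
    by_cases hy : f y = 0
    · have h0 (a : SmoothFun I M) : (c * a) y = 0 := by
        change f y * a y = 0
        rw [hy, zero_mul]
      have h0' : c y = 0 := hy
      simp [h0, h0']
    · have ho := hf.2 (subset_tsupport _ hy)
      conv_lhs => rw [← (frameBasis ho).sum_repr' (X y), Finset.smul_sum]
      refine Finset.sum_congr rfl fun i _ ↦ ?_
      rw [frameBasis_apply, smul_smul]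
      rfl
  have h2 := congrArg (fun Y ↦ T Y x) h1
  simp only [map_smul, map_sum, Field.sum_apply, Field.smul_apply] at h2
  have h3 : c x = 1 := f.eq_one
  have h4 (i) : (c * (leviCivita I M).g (e i) X) x = 0 := by
    change f x * inner ℝ (e i x) (X x) = 0
    rw [hX, inner_zero_right, mul_zero]
  simpa [h3, h4] using h2

theorem linear_apply_congr (T : Field I M →ₗ[SmoothFun I M] Field I M) {x : M} {X Y : Field I M}
    (h : X x = Y x) : T X x = T Y x := by
  have h0 : (X - Y) x = 0 := sub_eq_zero.2 h
  have := linear_apply_eq_zero T h0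
  rw [map_sub] at this
  exact sub_eq_zero.1 this

/-- The endomorphism of a tangent space induced by a function-linear operation on fields. -/
theorem exists_pointwise_linear (T : Field I M →ₗ[SmoothFun I M] Field I M) (x : M) :
    ∃ t : TangentSpace I x →ₗ[ℝ] TangentSpace I x, ∀ X : Field I M, t (X x) = T X x := by
  choose F hF using fun u : TangentSpace I x ↦ Field.exists_apply_eq u
  refine ⟨{ toFun := fun u ↦ T (F u) x, map_add' := fun u v ↦ ?_, map_smul' := fun a u ↦ ?_ },
    fun X ↦ linear_apply_congr T (hF _)⟩
  · rw [← Field.add_apply, ← map_add]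
    exact linear_apply_congr T (by rw [Field.add_apply, hF, hF, hF])
  · let c : SmoothFun I M := ⟨fun _ ↦ a, contMDiff_const⟩
    have : T (F (a • u)) x = T (c • F u) x :=
      linear_apply_congr T (by rw [Field.smul_apply, hF, hF]; rfl)
    rw [this, map_smul]
    rfl

theorem R_apply_congr {X X' Y Y' Z Z' : Field I M} {x : M} (hX : X x = X' x) (hY : Y x = Y' x)
    (hZ : Z x = Z' x) : (leviCivita I M).R X Y Z x = (leviCivita I M).R X' Y' Z' x := by
  simp only [← LeviCivitaAlgebra.Rlin_apply]
  rw [linear_apply_congr _ hZ]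
  have h1 := linear_apply_congr (((leviCivita I M).Rlin X).flip Z') hY
  have h2 := linear_apply_congr (((leviCivita I M).Rlin.flip Y').flip Z') hX
  exact h1.trans h2

/-- The extensions in `curvAt` are smooth only near `x`. Locality of `curv` replaces them by global
fields with the same germs, and tensoriality replaces those by `X, Y, Z`. -/
theorem curvAt_eq (X Y Z : Field I M) (x : M) :
    curvAt x (X x) (Y x) (Z x) = (leviCivita I M).R X Y Z x := by
  obtain ⟨X', hX, eX⟩ := exists_smoothField_eventuallyEq_extend (X x)
  obtain ⟨Y', hY, eY⟩ := exists_smoothField_eventuallyEq_extend (Y x)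
  obtain ⟨Z', hZ, eZ⟩ := exists_smoothField_eventuallyEq_extend (Z x)
  have h0 {u : TangentSpace I x} {W : Π x : M, TangentSpace I x}
      (h : ∀ᶠ y in 𝓝 x, W y = FiberBundle.extend (E := fun x : M ↦ TangentSpace I x) E u y) :
      W x = u := by
    rw [h.self_of_nhds, FiberBundle.extend_apply_self]
  rw [curvAt, ← curv_congr eX eY eZ]
  exact R_apply_congr (X := ⟨X', hX⟩) (Y := ⟨Y', hY⟩) (Z := ⟨Z', hZ⟩) (h0 eX) (h0 eY) (h0 eZ)

/-- The action on fields of a smooth endomorphism of the tangent bundle. -/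
def endField (φ : Π x : M, TangentSpace I x →L[ℝ] TangentSpace I x)
    (hφ : ContMDiff I (I.prod 𝓘(ℝ, E →L[ℝ] E)) ∞
      (fun x ↦ TotalSpace.mk' (E →L[ℝ] E)
        (E := fun x : M ↦ TangentSpace I x →L[ℝ] TangentSpace I x) x (φ x))) :
    Field I M →ₗ[SmoothFun I M] Field I M where
  toFun X := ⟨fun x ↦ φ x (X x), ContMDiff.clm_bundle_apply (b := fun x ↦ x) hφ X.contMDiff⟩
  map_add' X Y := by ext x; exact map_add (φ x) (X x) (Y x)
  map_smul' f X := by ext x; exact map_smul (φ x) (f x) (X x)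

theorem endField_apply (φ : Π x : M, TangentSpace I x →L[ℝ] TangentSpace I x)
    (hφ : ContMDiff I (I.prod 𝓘(ℝ, E →L[ℝ] E)) ∞
      (fun x ↦ TotalSpace.mk' (E →L[ℝ] E)
        (E := fun x : M ↦ TangentSpace I x →L[ℝ] TangentSpace I x) x (φ x)))
    (X : Field I M) (x : M) : endField φ hφ X x = φ x (X x) := rfl

/-- The `*`-Ricci tensor computed in an orthonormal frame. -/
theorem starRicci_eq_sum (φ : Π x : M, TangentSpace I x →L[ℝ] TangentSpace I x)
    (hφ : ContMDiff I (I.prod 𝓘(ℝ, E →L[ℝ] E)) ∞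
      (fun x ↦ TotalSpace.mk' (E →L[ℝ] E)
        (E := fun x : M ↦ TangentSpace I x →L[ℝ] TangentSpace I x) x (φ x)))
    (X Y : Field I M) {x : M} {e : Fin (finrank ℝ E) → Field I M}
    (he : Orthonormal ℝ (fun i ↦ e i x)) :
    starRicci φ x (X x) (Y x) = (1 / 2 : ℝ) * ∑ i,
      inner ℝ (endField φ hφ ((leviCivita I M).R X (endField φ hφ Y) (e i)) x) (e i x) := by
  obtain ⟨t, ht⟩ := exists_pointwise_linear
    (endField φ hφ ∘ₗ (leviCivita I M).Rlin X (endField φ hφ Y)) x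
  have h (u : TangentSpace I x) : φ x (curvAt x (X x) (φ x (Y x)) u) = t u := by
    obtain ⟨Z, rfl⟩ := Field.exists_apply_eq u
    rw [ht, ← endField_apply φ hφ, curvAt_eq]
    rfl
  have h1 := t.trace_eq_sum_inner (stdOrthonormalBasis ℝ (TangentSpace I x))
  rw [t.trace_eq_sum_inner (frameBasis he)] at h1
  simp only [frameBasis_apply, ht] at h1
  simp only [starRicci, h, real_inner_comm _ (t _), ← h1]
  congr 1
  exact Finset.sum_congr rfl fun i _ ↦ real_inner_comm _ _

/-- In the basis `b` the sum pairs the skew matrix of `w` with the symmetrization of the matrix of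
`t`. With `w i = ∇_ξ e_i`, it shows that rotating the frame does not change the trace. -/
theorem sum_inner_add_eq_zero {ι V : Type*} [Fintype ι] [NormedAddCommGroup V]
    [InnerProductSpace ℝ V] (b : OrthonormalBasis ι ℝ V) (t : V →ₗ[ℝ] V) (w : ι → V)
    (h : ∀ i j, inner ℝ (w i) (b j) + inner ℝ (b i) (w j) = (0 : ℝ)) :
    ∑ i, (inner ℝ (t (w i)) (b i) + inner ℝ (t (b i)) (w i) : ℝ) = 0 := by
  have h1 (i) : (inner ℝ (t (w i)) (b i) : ℝ) = ∑ j, inner ℝ (w i) (b j) * inner ℝ (t (b j)) (b i) := by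
    conv_lhs => rw [← b.sum_repr' (w i)]
    simp [sum_inner, real_inner_smul_left, real_inner_comm (w i)]
  have h2 (i) : (inner ℝ (t (b i)) (w i) : ℝ) = ∑ j, inner ℝ (w i) (b j) * inner ℝ (t (b i)) (b j) := by
    conv_lhs => rw [← b.sum_repr' (w i)]
    simp [inner_sum, real_inner_smul_right, real_inner_comm (w i)]
  simp only [Finset.sum_add_distrib, h1, h2]
  conv_lhs => rw [Finset.sum_comm, ← Finset.sum_add_distrib]
  refine Finset.sum_eq_zero fun i _ ↦ ?_
  rw [← Finset.sum_add_distrib]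
  refine Finset.sum_eq_zero fun j _ ↦ ?_
  rw [← add_mul, real_inner_comm (b j) (w i), h, zero_mul]

end Riem
end

/-! ### Kenmotsu manifolds and conclusion -/

noncomputable section

namespace Riem

variable {E : Type*} [NormedAddCommGroup E] [NormedSpace ℝ E] [FiniteDimensional ℝ E]
  {H : Type*} [TopologicalSpace H] {I : ModelWithCorners ℝ E H}
  {M : Type*} [TopologicalSpace M] [ChartedSpace H M] [IsManifold I ∞ M]
  [RiemannianBundle (fun x : M ↦ TangentSpace I x)]
  {φ : Π x : M, TangentSpace I x →L[ℝ] TangentSpace I x}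
  {ξ : Π x : M, TangentSpace I x} {η : Π x : M, TangentSpace I x →L[ℝ] ℝ}

namespace IsAlmostContactMetric

/-- Evaluating `φ³ξ` in two ways gives `φξ = aξ`, and then `φ²ξ = 0` forces `a² = 0`. -/
theorem phi_xi (hC : IsAlmostContactMetric φ ξ η) (x : M) : φ x (ξ x) = 0 := by
  have h1 : φ x (φ x (ξ x)) = 0 := by rw [hC.phi_sq, hC.eta_xi]; simp
  have h2 := hC.phi_sq x (φ x (ξ x))
  rw [h1, map_zero] at h2
  obtain ⟨a, ha⟩ : ∃ a : ℝ, φ x (ξ x) = a • ξ x :=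
    ⟨η x (φ x (ξ x)), by linear_combination (norm := module) h2⟩
  rw [ha, map_smul, ha, smul_smul] at h1
  have h3 : ξ x ≠ 0 := fun h ↦ by simpa [h] using hC.eta_xi x
  rw [ha, mul_self_eq_zero.1 ((smul_eq_zero.1 h1).resolve_right h3), zero_smul]

theorem inner_xi (hC : IsAlmostContactMetric φ ξ η) (x : M) (u : TangentSpace I x) :
    inner ℝ u (ξ x) = η x u := by
  have h := hC.compatible x u (ξ x)
  rw [hC.phi_xi, inner_zero_right, hC.eta_xi] at h
  linarith

theorem eta_phi (hC : IsAlmostContactMetric φ ξ η) (x : M) (u : TangentSpace I x) :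
    η x (φ x u) = 0 := by
  have h1 := congrArg (φ x) (hC.phi_sq x u)
  rw [hC.phi_sq x (φ x u), map_add, map_neg, map_smul, hC.phi_xi] at h1
  have h2 : η x (φ x u) • ξ x = 0 := by linear_combination (norm := module) h1
  have h3 : ξ x ≠ 0 := fun h ↦ by simpa [h] using hC.eta_xi x
  exact (smul_eq_zero.1 h2).resolve_right h3

theorem inner_phi_left (hC : IsAlmostContactMetric φ ξ η) (x : M) (u v : TangentSpace I x) :
    inner ℝ (φ x u) v = -(inner ℝ u (φ x v) : ℝ) := by
  have h := hC.compatible x u (φ x v)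
  rw [hC.phi_sq, hC.eta_phi, inner_add_right, inner_neg_right, real_inner_smul_right,
    hC.inner_xi, hC.eta_phi] at h
  linarith

end IsAlmostContactMetric

variable [IsContMDiffRiemannianBundle I ∞ E (fun x : M ↦ TangentSpace I x)] [T2Space M]

/-- The algebraic Kenmotsu structure of a Kenmotsu manifold. -/
def IsKenmotsu.algebra (hK : IsKenmotsu φ ξ η) : KenmotsuAlgebra (SmoothFun I M) (Field I M) where
  toLeviCivitaAlgebra := leviCivita I M
  φ := endField φ hK.smooth_phi
  ξ := ⟨ξ, hK.smooth_xi⟩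
  φ_sq X := by
    ext x
    exact (hK.phi_sq x (X x)).trans (by rw [← hK.inner_xi]; rfl)
  g_ξ_ξ := by ext x; exact (hK.inner_xi x (ξ x)).trans (hK.eta_xi x)
  φ_ξ := by ext x; exact hK.phi_xi x
  g_φ_ξ X := by ext x; exact (hK.inner_xi x _).trans (hK.eta_phi x _)
  φ_skew X Y := by ext x; exact hK.inner_phi_left x (X x) (Y x)
  nab_φ X Y := by
    ext x
    have h := hK.nabla_phi (fun y ↦ X y) (fun y ↦ Y y) X.smooth Y.smooth x
    rw [sub_eq_iff_eq_add', ← add_sub_assoc, ← hK.inner_xi] at h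
    exact h

theorem sum_apply_fun {ι : Type*} (s : Finset ι) (f : ι → SmoothFun I M) (x : M) :
    (∑ i ∈ s, f i) x = ∑ i ∈ s, f i x :=
  map_sum (ContMDiffMap.evalRingHom x) f s

theorem D_congr (X : Field I M) {f h : SmoothFun I M} {x : M} (hfh : ∀ᶠ y in 𝓝 x, f y = h y) :
    (leviCivita I M).D X f x = (leviCivita I M).D X h x :=
  dirDeriv_congr rfl hfh

theorem lieMetric_eq (V X Y : Field I M) (x : M) :
    lieMetric (fun y ↦ V y) (fun y ↦ X y) (fun y ↦ Y y) x = (leviCivita I M).deform V X Y x := by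
  have h1 := nabla_metric (V.smooth.mdifferentiableAt x) (X.smooth.mdifferentiableAt x)
    (Y.smooth.mdifferentiableAt x)
  rw [lieMetric, h1, ← nabla_torsion_free (V.smooth.mdifferentiableAt x)
    (X.smooth.mdifferentiableAt x), ← nabla_torsion_free (V.smooth.mdifferentiableAt x)
    (Y.smooth.mdifferentiableAt x), inner_sub_left, inner_sub_right]
  change _ = inner ℝ (nabla (fun y ↦ X y) (fun y ↦ V y) x) (Y x)
    + (inner ℝ (X x) (nabla (fun y ↦ Y y) (fun y ↦ V y) x) : ℝ)
  ring

/-- On a Kenmotsu manifold, `∇_ξ Ric^* = -2 Ric^* - 2 g(φ ·, φ ·)`. -/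
theorem IsKenmotsu.nabla_xi_starRicci (hK : IsKenmotsu φ ξ η)
    {S : Field I M → Field I M → SmoothFun I M}
    (hS : ∀ X Y x, S X Y x = starRicci φ x (X x) (Y x)) (X Y : Field I M) :
    hK.algebra.D hK.algebra.ξ (S X Y) - S (hK.algebra.nab hK.algebra.ξ X) Y
      - S X (hK.algebra.nab hK.algebra.ξ Y)
      = -2 * S X Y - 2 * hK.algebra.g (hK.algebra.φ X) (hK.algebra.φ Y) := by
  set K := hK.algebra
  ext x
  obtain ⟨e, he⟩ := Field.exists_orthonormal_frame (I := I) x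
  have hx := he.self_of_nhds
  have hS' (X Y : Field I M) {y : M} (hy : Orthonormal ℝ (fun i ↦ e i y)) :
      2 * S X Y y = ∑ i, K.g (K.φ (K.R X (K.φ Y) (e i))) (e i) y := by
    rw [hS, starRicci_eq_sum φ hK.smooth_phi X Y hy]
    rw [← mul_assoc, mul_one_div_cancel two_ne_zero, one_mul]
    rfl
  -- The frame formula for `2S` holds only near `x`, which suffices to differentiate it at `x`.
  have hD : 2 * K.D K.ξ (S X Y) x
      = ∑ i, K.D K.ξ (K.g (K.φ (K.R X (K.φ Y) (e i))) (e i)) x := by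
    have h1 : K.D K.ξ (S X Y + S X Y) x
        = K.D K.ξ (∑ i, K.g (K.φ (K.R X (K.φ Y) (e i))) (e i)) x := by
      refine D_congr _ ?_
      filter_upwards [he] with y hy
      rw [sum_apply_fun, ← hS' X Y hy, two_mul]
      rfl
    rw [map_add, map_sum, sum_apply_fun] at h1
    rw [← h1, two_mul]
    rfl
  obtain ⟨t, ht⟩ := exists_pointwise_linear (K.φ ∘ₗ K.Rlin X (K.φ Y)) x
  -- The products `g(e_i, e_j)` are constant near `x`, so `g(∇_ξ e_i, e_j)` is skew there.
  have hskew := sum_inner_add_eq_zero (frameBasis hx) t (fun i ↦ K.nab K.ξ (e i) x) (by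
    intro i j
    have h1 : K.D K.ξ (K.g (e i) (e j)) x = 0 := by
      have h2 : dirDeriv ξ (fun _ : M ↦ if i = j then (1 : ℝ) else 0) x = 0 := by
        rw [dirDeriv, mvfderiv_const]
        rfl
      rw [← h2]
      refine dirDeriv_congr rfl ?_
      filter_upwards [he] with y hy using orthonormal_iff_ite.1 hy i j
    rw [K.nab_metric] at h1
    simp only [frameBasis_apply]
    exact h1)
  simp only [frameBasis_apply, ht] at hskew
  -- Parseval sums the two constant-curvature terms; each contributes `g(φX, φY)`.
  have hsum (U W : Field I M) :
      ∑ i, K.g U (e i) x * K.g W (e i) x = K.g U W x := by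
    have h1 := (frameBasis hx).sum_inner_mul_inner (U x) (W x)
    simp only [frameBasis_apply] at h1
    refine Eq.trans (Finset.sum_congr rfl fun i _ ↦ ?_) h1
    rw [real_inner_comm (W x)]
    rfl
  have hterm (i) : K.D K.ξ (K.g (K.φ (K.R X (K.φ Y) (e i))) (e i)) x
      = -2 * (K.g (K.φ (K.R X (K.φ Y) (e i))) (e i) x
          + K.g (K.φ Y) (e i) x * K.g (K.φ X) (e i) x
          - K.g X (e i) x * K.g (K.φ (K.φ Y)) (e i) x)
        + K.g (K.φ (K.R (K.nab K.ξ X) (K.φ Y) (e i))) (e i) x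
        + K.g (K.φ (K.R X (K.φ (K.nab K.ξ Y)) (e i))) (e i) x
        + (K.g (K.φ (K.R X (K.φ Y) (K.nab K.ξ (e i)))) (e i) x
          + K.g (K.φ (K.R X (K.φ Y) (e i))) (K.nab K.ξ (e i)) x) := by
    have h := congrArg (ContMDiffMap.evalRingHom x) (K.D_ξ_trace_term X Y (e i))
    simp only [map_add, map_sub, map_mul, map_neg, map_ofNat] at h
    exact h
  have hskew' : ∑ i, (K.g (K.φ (K.R X (K.φ Y) (K.nab K.ξ (e i)))) (e i) x
          + K.g (K.φ (K.R X (K.φ Y) (e i))) (K.nab K.ξ (e i)) x) = 0 := hskew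
  have hφ : K.g X (K.φ (K.φ Y)) x = -K.g (K.φ X) (K.φ Y) x := by
    rw [K.φ_skew]
    exact (neg_neg _).symm
  simp only [hterm] at hD
  rw [Finset.sum_add_distrib, hskew', Finset.sum_add_distrib, Finset.sum_add_distrib,
    ← Finset.mul_sum, Finset.sum_sub_distrib, Finset.sum_add_distrib, hsum, hsum,
    ← hS' _ _ hx, ← hS' _ _ hx, ← hS' _ _ hx, hφ, K.g_comm (K.φ Y)] at hD
  have goal : K.D K.ξ (S X Y) x - S (K.nab K.ξ X) Y x - S X (K.nab K.ξ Y) x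
      = -2 * S X Y x - 2 * K.g (K.φ X) (K.φ Y) x := by
    linarith
  have hev (f : SmoothFun I M) : f x = ContMDiffMap.evalRingHom x f := rfl
  rw [hev, hev (_ - _)]
  simp only [map_sub, map_mul, map_neg, map_ofNat]
  exact goal

/-- An almost `*`-Ricci soliton on a Kenmotsu manifold of dimension at least two whose potential
field is a Jacobi field along the Reeb field is steady. -/
theorem IsKenmotsu.soliton_function_eq_zero (hK : IsKenmotsu φ ξ η) (hdim : 1 < finrank ℝ E)
    {V : Π x : M, TangentSpace I x} {lam : M → ℝ} (hS : IsAlmostStarRicciSoliton φ V lam)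
    (hJ : IsJacobiAlong ξ V) (x : M) : lam x = 0 := by
  let V' : Field I M := ⟨V, hS.smooth_field⟩
  let l : SmoothFun I M := ⟨lam, hS.smooth_lam⟩
  let K := hK.algebra
  have hsol (X Y : Field I M) (y : M) :
      starRicci φ y (X y) (Y y) = (l * K.g X Y - (1 / 2 : ℝ) • K.deform V' X Y) y := by
    have h := hS.soliton (fun z ↦ X z) (fun z ↦ Y z) X.smooth Y.smooth y
    have h' := lieMetric_eq V' X Y y
    have h'' : (l * K.g X Y - (1 / 2 : ℝ) • K.deform V' X Y) y
        = lam y * inner ℝ (X y) (Y y) - 1 / 2 * (leviCivita I M).deform V' X Y y := rfl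
    rw [h'', ← h']
    exact eq_sub_of_add_eq' h
  -- Smoothness of `Ric^*(X,Y)` comes for free: the soliton equation expresses it through `λ`, `g`
  -- and `L_V g`.
  let S (X Y : Field I M) : SmoothFun I M := l * K.g X Y - (1 / 2 : ℝ) • K.deform V' X Y
  have hS' (X Y : Field I M) (y : M) : S X Y y = starRicci φ y (X y) (Y y) := (hsol X Y y).symm
  have h1 (X Y : Field I M) : K.deform V' X Y + 2 * S X Y = 2 * l * K.g X Y := by
    have h : (2 : SmoothFun I M) * ((1 / 2 : ℝ) • K.deform V' X Y) = K.deform V' X Y := by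
      rw [two_mul, ← add_smul]
      norm_num
    simp only [S]
    linear_combination -h
  have h2 : S K.ξ K.ξ = 0 := by
    ext y
    obtain ⟨e, he⟩ := Field.exists_orthonormal_frame (I := I) y
    rw [hS', starRicci_eq_sum φ hK.smooth_phi _ _ he.self_of_nhds]
    have h0 (Z : Field I M) : K.φ (K.R K.ξ (K.φ K.ξ) Z) = 0 := by
      rw [K.φ_ξ, ← K.Rlin_apply]
      simp
    have h0' (i) : inner ℝ (K.φ (K.R K.ξ (K.φ K.ξ) (e i)) y) (e i y) = (0 : ℝ) := by
      rw [h0]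
      exact inner_zero_left _
    exact mul_eq_zero_of_right _ (Finset.sum_eq_zero fun i _ ↦ h0' i)
  have h3 : K.nab K.ξ (K.nab K.ξ V') + K.R V' K.ξ K.ξ = 0 := by
    ext y
    exact hJ y
  -- If `φ` vanished at `x`, then `φ² = -id + η ⊗ ξ` would make `ξ` span the tangent space.
  obtain ⟨u, hu⟩ : ∃ u : TangentSpace I x, φ x u ≠ 0 := by
    by_contra! h
    have h4 : finrank ℝ (TangentSpace I x) ≤ 1 := by
      refine finrank_le_one (ξ x) fun w ↦ ⟨η x w, ?_⟩
      have := hK.phi_sq x w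
      rw [h w, map_zero] at this
      linear_combination (norm := module) -this
    exact absurd h4 (not_le.2 hdim)
  obtain ⟨X, rfl⟩ := Field.exists_apply_eq u
  -- Both arguments are `φX`, which is orthogonal to `ξ` everywhere and nonzero at `x`.
  have h5 := K.soliton_steady h1 h2 (hK.nabla_xi_starRicci hS') h3 (K.g_φ_ξ X) (K.g_φ_ξ X)
  have h6 : lam x * inner ℝ (φ x (X x)) (φ x (X x)) = 0 :=
    congrArg (fun f : SmoothFun I M ↦ f x) h5
  exact (mul_eq_zero.1 h6).resolve_right (inner_self_ne_zero.2 hu)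

end Riem
end
theorem mainTheorem2 (n : ℕ) (hn : 1 < n)
    {M : Type*} [TopologicalSpace M] [T2Space M] [SecondCountableTopology M]
    [ChartedSpace (EuclideanSpace ℝ (Fin (2 * n + 1))) M]
    [IsManifold (𝓡 (2 * n + 1)) ∞ M]
    [RiemannianBundle (fun x : M ↦ TangentSpace (𝓡 (2 * n + 1)) x)]
    [IsContMDiffRiemannianBundle (𝓡 (2 * n + 1)) ∞ (EuclideanSpace ℝ (Fin (2 * n + 1)))
      (fun x : M ↦ TangentSpace (𝓡 (2 * n + 1)) x)]
    (φ : Π x : M, TangentSpace (𝓡 (2 * n + 1)) x →L[ℝ] TangentSpace (𝓡 (2 * n + 1)) x)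
    (ξ : Π x : M, TangentSpace (𝓡 (2 * n + 1)) x)
    (η : Π x : M, TangentSpace (𝓡 (2 * n + 1)) x →L[ℝ] ℝ)
    (hK : Riem.IsKenmotsu φ ξ η)
    (V : Π x : M, TangentSpace (𝓡 (2 * n + 1)) x) (lam : M → ℝ)
    (hS : Riem.IsAlmostStarRicciSoliton φ V lam)
    (hJ : Riem.IsJacobiAlong ξ V) :
    (∃ c : ℝ, ∀ x : M, lam x = c) ∧ ∀ x : M, lam x = 0 := by
  have h : ∀ x, lam x = 0 :=
    hK.soliton_function_eq_zero (by rw [finrank_euclideanSpace_fin]; omega) hS hJ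
  exact ⟨⟨0, h⟩, h⟩
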